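/- For a nonnegative integer $k$ let $H_k=\sum_{j=1}^{k}\frac1j$ (so $H_0=0$). For every integer $n\ge 1$ and every real $t$ with $0<t\le 1$, the series on the left-hand side below converges and \begin{align*} \sum_{k=1}^{\infty}\frac{H_{k-1}t^k}{k\binom{n+k}{k}}={}&\frac12\log^2(1-t)+\frac{t\log(1-t)}{1-t}\sum_{k=1}^{n}\frac1k\left(\frac{t-1}{t}\right)^k+\frac{\log^2(1-t)}{2(1-t)}\sum_{k=1}^{n}\left(\frac{t-1}{t}\right)^k\\ &-\frac{t}{1-t}\sum_{k=1}^{n}\frac{H_k}{k}\left(\frac{t-1}{t}\right)^k\\ &+\frac{1}{1-t}\sum_{p=0}^{n-1}\left\{\sum_{k=1}^{n-p}\left(\frac{H_{p+k}-H_k}{(p+k)k}+\frac{1}{k^2(p+k)}\right)\right\}p\left(\frac{t-1}{t}\right)^p\\ &-\frac{\log(1-t)}{1-t}\sum_{k=1}^{n}H_k\left(\frac{t-1}{t}\right)^k, \end{align*} where for $t=1$ the right-hand side is understood as its limit as $t\to1^-$ (which exists). -/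

import Mathlib

open Filter Topology

noncomputable section

/-- The coefficient `∑_{k=1}^{n-p} ((H_{p+k} - H_k)/((p+k)k) + 1/(k²(p+k)))`. -/
def coeffC (n p : ℕ) : ℝ :=
  ∑ k ∈ Finset.Icc 1 (n - p),
    (((harmonic (p + k) : ℝ) - (harmonic k : ℝ)) / (((p : ℝ) + (k : ℝ)) * (k : ℝ))
      + 1 / ((k : ℝ) ^ 2 * ((p : ℝ) + (k : ℝ))))

/-- The closed form, as a function of `t` (meaningful for `0 < t < 1`). -/
def closedForm (n : ℕ) (t : ℝ) : ℝ :=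
  1 / 2 * Real.log (1 - t) ^ 2
    + t * Real.log (1 - t) / (1 - t)
        * ∑ k ∈ Finset.Icc 1 n, 1 / (k : ℝ) * ((t - 1) / t) ^ k
    + Real.log (1 - t) ^ 2 / (2 * (1 - t))
        * ∑ k ∈ Finset.Icc 1 n, ((t - 1) / t) ^ k
    - t / (1 - t)
        * ∑ k ∈ Finset.Icc 1 n, (harmonic k : ℝ) / (k : ℝ) * ((t - 1) / t) ^ k
    + 1 / (1 - t)
        * ∑ p ∈ Finset.range n, coeffC n p * (p : ℝ) * ((t - 1) / t) ^ p
    - Real.log (1 - t) / (1 - t)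
        * ∑ k ∈ Finset.Icc 1 n, (harmonic k : ℝ) * ((t - 1) / t) ^ k

/-- The summand `H_{k-1} t^k / (k * binom(n+k, k))`, used for `k ≥ 1`. -/
def seriesTerm (n : ℕ) (t : ℝ) (k : ℕ) : ℝ :=
  (harmonic (k - 1) : ℝ) * t ^ k / ((k : ℝ) * ((n + k).choose k : ℝ))

end

/-!
Write `x = (t - 1) / t`, `L = log (1 - t)` and `β(n, k) = 1 / (k * binom(n + k, k))`, which is the
Beta integral `∫₀¹ u^(k-1) (1-u)^n du`. The difference equation `β(n+1, k) = β(n, k) - β(n, k+1)`,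
multiplied by `t^k` or by `H_{k-1} t^k` and summed over `k`, shows that
`T n = ∑ β(n, k) t^k` and `S n = ∑ H_{k-1} β(n, k) t^k` satisfy
`T (n+1) = x * T n + 1 / (n+1)` and `S (n+1) = x * S n + T (n+1) / (n+1)`.
The initial values are `T 0 = -L` and `S 0 = L² / 2`, the latter being the Cauchy square of the
logarithmic series. Solving the recurrences (`hasSum_betaCoeff`, `hasSum_seriesTerm`) gives
`S n = x^n L² / 2 - H_n L x^n + ∑_{j<n} (H_n - H_j) / (j+1) * x^(n-1-j)`.

The closed form reduces to this expression coefficient by coefficient in `L` (`closedForm_eq`);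
the only part which is not a geometric sum or a telescoping sum rests on a two-term recurrence
in `p` for `coeffC n p` (`coeffC_recurrence`).

At `t = 1` all powers of `x` vanish fast enough to absorb the logarithms, so that the expression
tends to `1 / n²`. As the terms of the series are nonnegative and increase with `t`, this limit is
also the sum of the series at `t = 1`.
-/

open Finset

/-! ### The Beta coefficients -/

/-- The number `1 / ((k+1) * binom(n+k+1, k+1))`, that is, the Beta integral
`∫₀¹ u^k (1-u)^n du`. The index `k` is shifted by one with respect to `seriesTerm`. -/
noncomputable def betaCoeff (n k : ℕ) : ℝ := 1 / (((k + 1 : ℕ) : ℝ) * ((n + (k + 1)).choose (k + 1) : ℝ))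

lemma betaCoeff_eq_factorial (n k : ℕ) :
    betaCoeff n k = (k.factorial : ℝ) * n.factorial / (n + k + 1).factorial := by
  have h := Nat.add_choose_mul_factorial_mul_factorial n (k + 1)
  have h2 : ((n + (k + 1)).choose (k + 1) : ℝ) * n.factorial * ((k + 1) * k.factorial)
      = (n + k + 1).factorial := by
    rw [Nat.factorial_succ k] at h
    exact_mod_cast h
  have hc : ((n + (k + 1)).choose (k + 1) : ℝ) ≠ 0 := by
    exact_mod_cast (Nat.choose_pos (by omega)).ne'
  have hf : ((n + k + 1).factorial : ℝ) ≠ 0 := by positivity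
  rw [betaCoeff, div_eq_div_iff (by positivity) hf, ← h2]
  push_cast
  ring

lemma betaCoeff_succ_left (n k : ℕ) :
    betaCoeff (n + 1) k = betaCoeff n k - betaCoeff n (k + 1) := by
  simp only [betaCoeff_eq_factorial]
  rw [show n + 1 + k + 1 = (n + k + 1) + 1 by ring, show n + (k + 1) + 1 = (n + k + 1) + 1 by ring,
    Nat.factorial_succ (n + k + 1), Nat.factorial_succ n, Nat.factorial_succ k]
  have hf : ((n + k + 1).factorial : ℝ) ≠ 0 := by positivity
  push_cast
  field_simp
  ring

lemma betaCoeff_succ_right_div (n k : ℕ) :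
    betaCoeff n (k + 1) / (k + 1) = betaCoeff (n + 1) k / (n + 1) := by
  simp only [betaCoeff_eq_factorial]
  rw [show n + 1 + k + 1 = (n + k + 1) + 1 by ring, show n + (k + 1) + 1 = (n + k + 1) + 1 by ring,
    Nat.factorial_succ n, Nat.factorial_succ k]
  push_cast
  field_simp

lemma betaCoeff_zero_left (k : ℕ) : betaCoeff 0 k = 1 / (k + 1) := by
  simp [betaCoeff]

lemma betaCoeff_zero_right (n : ℕ) : betaCoeff n 0 = 1 / (n + 1) := by
  simp [betaCoeff]

lemma seriesTerm_succ (n : ℕ) (t : ℝ) (k : ℕ) :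
    seriesTerm n t (k + 1) = (harmonic k : ℝ) * t ^ (k + 1) * betaCoeff n k := by
  simp only [seriesTerm, betaCoeff, Nat.add_sub_cancel]
  ring

lemma harmonic_succ_real (n : ℕ) :
    (harmonic (n + 1) : ℝ) = harmonic n + 1 / ((n : ℝ) + 1) := by
  rw [harmonic_succ]
  push_cast
  rw [one_div]

/-! ### Solution polynomials of the two recurrences -/

/-- The solution of `P (n+1) = x * P n + 1 / (n+1)`, `P 0 = 0`. -/
noncomputable def recipPoly (n : ℕ) (x : ℝ) : ℝ :=
  ∑ j ∈ range n, 1 / ((j : ℝ) + 1) * x ^ (n - 1 - j)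

/-- The solution of `Q (n+1) = x * Q n + recipPoly (n+1) x / (n+1)`, `Q 0 = 0`; it is the part of
the sum of the series that is free of logarithms. -/
noncomputable def harmonicPoly (n : ℕ) (x : ℝ) : ℝ :=
  ∑ j ∈ range n, ((harmonic n : ℝ) - harmonic j) / ((j : ℝ) + 1) * x ^ (n - 1 - j)

lemma pow_succ_sub_one_sub {n j : ℕ} (hj : j < n) (x : ℝ) :
    x ^ (n + 1 - 1 - j) = x * x ^ (n - 1 - j) := by
  rw [← pow_succ']
  congr 1
  omega

lemma recipPoly_succ (n : ℕ) (x : ℝ) :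
    recipPoly (n + 1) x = x * recipPoly n x + 1 / ((n : ℝ) + 1) := by
  rw [recipPoly, recipPoly, sum_range_succ, mul_sum]
  congr 1
  · refine sum_congr rfl fun j hj => ?_
    rw [pow_succ_sub_one_sub (mem_range.mp hj)]
    ring
  · simp

lemma harmonicPoly_succ (n : ℕ) (x : ℝ) :
    harmonicPoly (n + 1) x = x * harmonicPoly n x + recipPoly (n + 1) x / ((n : ℝ) + 1) := by
  rw [recipPoly, harmonicPoly, harmonicPoly, sum_range_succ, sum_range_succ _ n, mul_sum, add_div,
    sum_div, ← add_assoc, ← sum_add_distrib]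
  congr 1
  · refine sum_congr rfl fun j hj => ?_
    rw [pow_succ_sub_one_sub (mem_range.mp hj), harmonic_succ_real]
    field_simp
    ring
  · rw [harmonic_succ_real]
    simp

/-! ### Summation of the series for `0 < t < 1` -/

/-- The Cauchy square of the logarithmic series, rewritten by
`1 / (i j) = (1 / i + 1 / j) / (i + j)`. -/
lemma hasSum_harmonic_mul_pow_div {t : ℝ} (h0 : 0 < t) (h1 : t < 1) :
    HasSum (fun k : ℕ => (harmonic k : ℝ) * t ^ (k + 1) / ((k : ℝ) + 1))
      (1 / 2 * Real.log (1 - t) ^ 2) := by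
  have hlog := Real.hasSum_pow_div_log_of_abs_lt_one (x := t)
    (by rw [abs_lt]; constructor <;> linarith)
  set f : ℕ → ℝ := fun n => t ^ (n + 1) / ((n : ℝ) + 1) with hf
  have hnorm : Summable fun n => ‖f n‖ := hlog.summable.norm
  have hcoeff : ∀ n, ∑ kl ∈ antidiagonal n, f kl.1 * f kl.2
      = 2 * ((harmonic (n + 1) : ℝ) * t ^ (n + 1 + 1) / (((n + 1 : ℕ) : ℝ) + 1)) := by
    intro n
    have hterm : ∀ kl ∈ antidiagonal n, f kl.1 * f kl.2
        = t ^ (n + 2) / ((n : ℝ) + 2) * (1 / ((kl.1 : ℝ) + 1))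
          + t ^ (n + 2) / ((n : ℝ) + 2) * (1 / ((kl.2 : ℝ) + 1)) := by
      rintro ⟨i, j⟩ hij
      rw [HasAntidiagonal.mem_antidiagonal] at hij
      subst hij
      simp only [hf]
      push_cast
      have : (i : ℝ) + j + 2 ≠ 0 := by positivity
      field_simp
      ring
    have hharm : ∑ i ∈ range (n + 1), 1 / ((i : ℝ) + 1) = harmonic (n + 1) := by
      simp [harmonic]
    rw [sum_congr rfl hterm, sum_add_distrib, ← mul_sum, ← mul_sum,
      Nat.sum_antidiagonal_eq_sum_range_succ (fun i _ => 1 / ((i : ℝ) + 1)),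
      ← Nat.sum_antidiagonal_swap (n := n) (f := fun kl => 1 / ((kl.2 : ℝ) + 1))]
    simp only [Prod.snd_swap]
    rw [Nat.sum_antidiagonal_eq_sum_range_succ (fun i _ => 1 / ((i : ℝ) + 1)), hharm]
    push_cast
    ring
  have hsum := (summable_norm_sum_mul_antidiagonal_of_summable_norm hnorm hnorm).of_norm.hasSum
  rw [← tsum_mul_tsum_eq_tsum_sum_antidiagonal_of_summable_norm hnorm hnorm, hlog.tsum_eq] at hsum
  simp only [hcoeff] at hsum
  refine (hasSum_nat_add_iff' 1).mp ?_
  convert! hsum.div_const 2 using 1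
  · funext k
    ring
  · simp
    ring

lemma hasSum_betaCoeff (n : ℕ) {t : ℝ} (h0 : 0 < t) (h1 : t < 1) :
    HasSum (fun k : ℕ => t ^ (k + 1) * betaCoeff n k)
      (-Real.log (1 - t) * ((t - 1) / t) ^ n + recipPoly n ((t - 1) / t)) := by
  induction n with
  | zero =>
    have h := Real.hasSum_pow_div_log_of_abs_lt_one (x := t)
      (by rw [abs_lt]; constructor <;> linarith)
    simpa [betaCoeff_zero_left, div_eq_mul_inv, recipPoly] using h
  | succ n ih =>
    have hshift := ((hasSum_nat_add_iff' 1).mpr ih).div_const t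
    convert! ih.sub hshift using 1
    · funext k
      rw [betaCoeff_succ_left]
      field_simp
      ring
    · rw [recipPoly_succ]
      simp only [sum_range_one, betaCoeff_zero_right]
      have ht : t * t⁻¹ = 1 := mul_inv_cancel₀ h0.ne'
      have hx : t⁻¹ = 1 - (t - 1) / t := by
        field_simp
        ring
      generalize (t - 1) / t = x at hx ⊢
      linear_combination
        (-Real.log (1 - t) * x ^ n + recipPoly n x) * hx - 1 / ((n : ℝ) + 1) * ht

lemma hasSum_seriesTerm (n : ℕ) {t : ℝ} (h0 : 0 < t) (h1 : t < 1) :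
    HasSum (fun k : ℕ => seriesTerm n t (k + 1))
      (1 / 2 * Real.log (1 - t) ^ 2 * ((t - 1) / t) ^ n
        - harmonic n * Real.log (1 - t) * ((t - 1) / t) ^ n
        + harmonicPoly n ((t - 1) / t)) := by
  simp only [seriesTerm_succ]
  induction n with
  | zero =>
    simpa [betaCoeff_zero_left, div_eq_mul_inv, harmonicPoly] using
      hasSum_harmonic_mul_pow_div h0 h1
  | succ n ih =>
    have hshift := ((hasSum_nat_add_iff' 1).mpr ih).div_const t
    have hbeta := (hasSum_betaCoeff (n + 1) h0 h1).div_const ((n : ℝ) + 1)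
    convert! (ih.sub hshift).add hbeta using 1
    · funext k
      -- `H_k = H_{k+1} - 1 / (k+1)` splits `H_k β(n, k+1)` into a term of `S n` and one of `T (n+1)`
      rw [mul_div_assoc (t ^ (k + 1)), ← betaCoeff_succ_right_div, betaCoeff_succ_left,
        harmonic_succ_real]
      field_simp
      ring
    · rw [harmonicPoly_succ, harmonic_succ_real]
      simp only [sum_range_one, harmonic_zero]
      have hx : t⁻¹ = 1 - (t - 1) / t := by
        field_simp
        ring
      generalize (t - 1) / t = x at hx ⊢
      push_cast
      linear_combination
        (1 / 2 * Real.log (1 - t) ^ 2 * x ^ n - harmonic n * Real.log (1 - t) * x ^ n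
          + harmonicPoly n x) * hx

/-! ### Evaluation of the closed form -/

lemma sum_Icc_one_eq_sum_range (f : ℕ → ℝ) (n : ℕ) :
    ∑ k ∈ Icc 1 n, f k = ∑ k ∈ range n, f (k + 1) := by
  rw [range_eq_Ico, sum_Ico_add' f 0 n 1]
  rfl

lemma coeffC_succ {n p : ℕ} (hp : p ≤ n) :
    coeffC (n + 1) p = coeffC n p
      + (((harmonic (n + 1) : ℝ) - harmonic (n + 1 - p)) / (((n : ℝ) + 1) * ((n : ℝ) + 1 - p))
        + 1 / (((n : ℝ) + 1 - p) ^ 2 * ((n : ℝ) + 1))) := by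
  obtain ⟨m, rfl⟩ := Nat.exists_eq_add_of_le hp
  rw [coeffC, coeffC, show p + m + 1 - p = m + 1 by omega, show p + m - p = m by omega,
    sum_Icc_succ_top (by omega), show p + (m + 1) = p + m + 1 by ring]
  push_cast
  ring_nf

lemma coeffC_self (n : ℕ) : coeffC n n = 0 := by
  simp [coeffC]

/-- The two-term recurrence of `coeffC` in `p`, with `n = p + 1 + m`; it says that
`(1 - 1 / x) * ∑ p * coeffC n p * x^p` and `harmonicPoly n x` differ by `∑ H_{p+1} / (p+1) * x^p`. -/
lemma coeffC_recurrence (p m : ℕ) :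
    ((p : ℝ) + 1) * coeffC (p + 1 + m) (p + 1) - p * coeffC (p + 1 + m) p
      = (harmonic (p + 1) : ℝ) / ((p : ℝ) + 1)
        - ((harmonic (p + 1 + m) : ℝ) - harmonic m) / ((m : ℝ) + 1) := by
  induction m with
  | zero =>
    rw [add_zero, coeffC_self, coeffC_succ le_rfl, coeffC_self]
    simp only [Nat.add_sub_cancel_left, harmonic_succ_real, harmonic_zero]
    push_cast
    field_simp
    ring
  | succ m ih =>
    rw [← add_assoc, coeffC_succ (n := p + 1 + m) (p := p + 1) (by omega),
      coeffC_succ (n := p + 1 + m) (p := p) (by omega),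
      show p + 1 + m + 1 - (p + 1) = m + 1 by omega,
      show p + 1 + m + 1 - p = m + 1 + 1 by omega]
    have ih' := eq_add_of_sub_eq ih
    have h1 : ((p + 1 + m : ℕ) : ℝ) + 1 - ((p + 1 : ℕ) : ℝ) = (m : ℝ) + 1 := by push_cast; ring
    have h2 : ((p + 1 + m : ℕ) : ℝ) + 1 - (p : ℝ) = (m : ℝ) + 2 := by push_cast; ring
    have h3 : ((p + 1 + m : ℕ) : ℝ) + 1 = (p : ℝ) + m + 2 := by push_cast; ring
    have h4 : (p : ℝ) + m + 2 ≠ 0 := by positivity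
    have h5 : (m : ℝ) + 1 + 1 ≠ 0 := by positivity
    rw [h1, h2, mul_add, ih', harmonic_succ_real (p + 1 + m), harmonic_succ_real (m + 1),
      harmonic_succ_real m, h3]
    push_cast
    field_simp
    ring

lemma harmonicPoly_eq_sum_coeffC (n : ℕ) (x : ℝ) :
    harmonicPoly n x = ∑ p ∈ range n, (harmonic (p + 1) : ℝ) / ((p : ℝ) + 1) * x ^ p
      + ∑ p ∈ range n, coeffC n p * (p : ℝ) * x ^ p
      - ∑ p ∈ range n, coeffC n (p + 1) * ((p : ℝ) + 1) * x ^ p := by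
  rw [harmonicPoly, ← sum_range_reflect, ← sum_add_distrib, ← sum_sub_distrib]
  refine sum_congr rfl fun p hp => ?_
  obtain ⟨m, rfl⟩ := Nat.exists_eq_add_of_lt (mem_range.mp hp)
  have h := coeffC_recurrence p m
  rw [show p + m + 1 - 1 - p = m by omega, show p + m + 1 - 1 - m = p by omega,
    show p + m + 1 = p + 1 + m by ring]
  linear_combination x ^ p * h

lemma sum_coeffC_shift (n : ℕ) (x : ℝ) :
    ∑ p ∈ range n, coeffC n p * (p : ℝ) * x ^ p
      = x * ∑ p ∈ range n, coeffC n (p + 1) * ((p : ℝ) + 1) * x ^ p := by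
  have h1 := sum_range_succ (fun p => coeffC n p * (p : ℝ) * x ^ p) n
  have h2 := sum_range_succ' (fun p => coeffC n p * (p : ℝ) * x ^ p) n
  simp only [coeffC_self, zero_mul, add_zero, Nat.cast_zero, mul_zero, Nat.cast_add,
    Nat.cast_one] at h1 h2
  rw [← h1, h2, mul_sum]
  exact sum_congr rfl fun p _ => by ring

lemma sum_pow_div_eq {t : ℝ} (h0 : 0 < t) (h1 : t < 1) (n : ℕ) :
    1 / (1 - t) * ∑ k ∈ Icc 1 n, ((t - 1) / t) ^ k = ((t - 1) / t) ^ n - 1 := by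
  have h : 1 - t ≠ 0 := by linarith
  induction n with
  | zero => simp
  | succ n ih =>
    rw [sum_Icc_succ_top (by omega), mul_add, ih, pow_succ]
    field_simp
    ring

lemma sum_harmonic_pow_eq {t : ℝ} (h0 : 0 < t) (h1 : t < 1) (n : ℕ) :
    t / (1 - t) * ∑ k ∈ Icc 1 n, 1 / (k : ℝ) * ((t - 1) / t) ^ k
      - 1 / (1 - t) * ∑ k ∈ Icc 1 n, (harmonic k : ℝ) * ((t - 1) / t) ^ k
      = -harmonic n * ((t - 1) / t) ^ n := by
  have h : 1 - t ≠ 0 := by linarith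
  induction n with
  | zero => simp
  | succ n ih =>
    rw [sum_Icc_succ_top (by omega), sum_Icc_succ_top (by omega), mul_add, mul_add,
      add_sub_add_comm, ih, pow_succ, harmonic_succ_real]
    push_cast
    field_simp
    ring

lemma sum_coeffC_eq {t : ℝ} (h0 : 0 < t) (h1 : t < 1) (n : ℕ) :
    1 / (1 - t) * ∑ p ∈ range n, coeffC n p * (p : ℝ) * ((t - 1) / t) ^ p
      - t / (1 - t) * ∑ k ∈ Icc 1 n, (harmonic k : ℝ) / (k : ℝ) * ((t - 1) / t) ^ k
      = harmonicPoly n ((t - 1) / t) := by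
  have h : 1 - t ≠ 0 := by linarith
  have hx : ∑ k ∈ Icc 1 n, (harmonic k : ℝ) / (k : ℝ) * ((t - 1) / t) ^ k
      = ((t - 1) / t)
        * ∑ p ∈ range n, (harmonic (p + 1) : ℝ) / ((p : ℝ) + 1) * ((t - 1) / t) ^ p := by
    rw [sum_Icc_one_eq_sum_range, mul_sum]
    refine sum_congr rfl fun p _ => ?_
    push_cast
    ring
  rw [hx, harmonicPoly_eq_sum_coeffC, sum_coeffC_shift]
  field_simp
  ring

lemma closedForm_eq {t : ℝ} (h0 : 0 < t) (h1 : t < 1) (n : ℕ) :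
    closedForm n t = 1 / 2 * Real.log (1 - t) ^ 2 * ((t - 1) / t) ^ n
        - harmonic n * Real.log (1 - t) * ((t - 1) / t) ^ n
        + harmonicPoly n ((t - 1) / t) := by
  have e1 := sum_pow_div_eq h0 h1 n
  have e2 := sum_harmonic_pow_eq h0 h1 n
  have e3 := sum_coeffC_eq h0 h1 n
  have hhalf : Real.log (1 - t) ^ 2 / (2 * (1 - t))
      = 1 / 2 * Real.log (1 - t) ^ 2 * (1 / (1 - t)) := by
    rw [mul_comm 2, ← div_div]
    ring
  rw [closedForm, hhalf]
  linear_combination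
    (1 / 2 * Real.log (1 - t) ^ 2) * e1 + Real.log (1 - t) * e2 + e3

/-! ### The endpoint `t = 1` -/

lemma tendsto_one_sub_nhdsLT_one : Tendsto (fun t : ℝ => 1 - t) (𝓝[<] 1) (𝓝[>] 0) := by
  refine tendsto_nhdsWithin_iff.mpr ⟨?_, ?_⟩
  · have h : Continuous fun t : ℝ => 1 - t := by fun_prop
    simpa using (h.tendsto 1).mono_left nhdsWithin_le_nhds
  · filter_upwards [self_mem_nhdsWithin] with t ht
    exact sub_pos.mpr (Set.mem_Iio.mp ht)

lemma tendsto_log_sq_mul_one_sub :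
    Tendsto (fun t : ℝ => Real.log (1 - t) ^ 2 * (1 - t)) (𝓝[<] 1) (𝓝 0) := by
  have h := ((tendsto_log_mul_rpow_nhdsGT_zero (r := 1 / 2) (by norm_num)).comp
    tendsto_one_sub_nhdsLT_one).pow 2
  rw [zero_pow two_ne_zero] at h
  refine h.congr' ?_
  filter_upwards [self_mem_nhdsWithin] with t ht
  rw [Function.comp_apply, mul_pow, ← Real.sqrt_eq_rpow,
    Real.sq_sqrt (sub_nonneg.mpr (le_of_lt (Set.mem_Iio.mp ht)))]

lemma tendsto_log_mul_one_sub :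
    Tendsto (fun t : ℝ => Real.log (1 - t) * (1 - t)) (𝓝[<] 1) (𝓝 0) := by
  have h := (tendsto_log_mul_rpow_nhdsGT_zero one_pos).comp tendsto_one_sub_nhdsLT_one
  simpa only [Real.rpow_one, Function.comp_def] using h

lemma tendsto_closedForm {n : ℕ} (hn : 1 ≤ n) :
    Tendsto (fun t : ℝ => closedForm n t) (𝓝[<] (1 : ℝ)) (𝓝 (harmonicPoly n 0)) := by
  obtain ⟨m, rfl⟩ := Nat.exists_eq_add_of_le' hn
  have hx : Tendsto (fun t : ℝ => (t - 1) / t) (𝓝[<] 1) (𝓝 0) := by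
    have : ContinuousAt (fun t : ℝ => (t - 1) / t) 1 := by fun_prop (disch := norm_num)
    simpa using this.tendsto.mono_left nhdsWithin_le_nhds
  have hpoly : Tendsto (fun t : ℝ => harmonicPoly (m + 1) ((t - 1) / t)) (𝓝[<] 1)
      (𝓝 (harmonicPoly (m + 1) 0)) := by
    have : Continuous (harmonicPoly (m + 1)) := by unfold harmonicPoly; fun_prop
    exact (this.tendsto 0).comp hx
  have hfac : Tendsto (fun t : ℝ => -(((t - 1) / t) ^ m / t)) (𝓝[<] 1) (𝓝 (-(0 ^ m / 1))) :=
    ((hx.pow m).div (tendsto_id.mono_left nhdsWithin_le_nhds) one_ne_zero).neg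
  have h := (((tendsto_log_sq_mul_one_sub.const_mul (1 / 2)).sub
    (tendsto_log_mul_one_sub.const_mul (harmonic (m + 1) : ℝ))).mul hfac).add hpoly
  simp only [mul_zero, sub_zero, zero_mul, zero_add] at h
  refine h.congr' ?_
  filter_upwards [Ioo_mem_nhdsLT (zero_lt_one' ℝ)] with t ht
  rw [closedForm_eq ht.1 ht.2, pow_succ]
  ring

lemma seriesTerm_nonneg (n k : ℕ) {t : ℝ} (h0 : 0 ≤ t) : 0 ≤ seriesTerm n t (k + 1) := by
  rw [seriesTerm_succ, betaCoeff]
  have : (0 : ℝ) ≤ harmonic k := by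
    rw [harmonic]
    push_cast
    positivity
  positivity

lemma seriesTerm_le_seriesTerm_one (n k : ℕ) {t : ℝ} (h0 : 0 ≤ t) (h1 : t ≤ 1) :
    seriesTerm n t (k + 1) ≤ seriesTerm n 1 (k + 1) := by
  have h := mul_le_mul_of_nonneg_left (pow_le_one₀ h0 h1 : t ^ (k + 1) ≤ 1)
    (seriesTerm_nonneg n k zero_le_one)
  simp only [seriesTerm_succ, one_pow] at h ⊢
  linarith

/-- Monotone convergence at the endpoint: a left limit at `1` of the sums is the sum at `1`. -/
lemma hasSum_seriesTerm_one {n : ℕ} {g : ℝ → ℝ} {S : ℝ}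
    (hg : ∀ t : ℝ, 0 < t → t < 1 → HasSum (fun k : ℕ => seriesTerm n t (k + 1)) (g t))
    (hS : Tendsto g (𝓝[<] 1) (𝓝 S)) :
    HasSum (fun k : ℕ => seriesTerm n 1 (k + 1)) S := by
  have hev : ∀ᶠ t : ℝ in 𝓝[<] 1, t ∈ Set.Ioo 0 1 := Ioo_mem_nhdsLT zero_lt_one
  have hpartial : ∀ N, ∑ k ∈ range N, seriesTerm n 1 (k + 1) ≤ S := by
    intro N
    have hcont : Tendsto (fun t : ℝ => ∑ k ∈ range N, seriesTerm n t (k + 1)) (𝓝[<] 1)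
        (𝓝 (∑ k ∈ range N, seriesTerm n 1 (k + 1))) := by
      have : Continuous fun t : ℝ => ∑ k ∈ range N, seriesTerm n t (k + 1) := by
        simp only [seriesTerm_succ]
        fun_prop
      exact (this.tendsto 1).mono_left nhdsWithin_le_nhds
    refine le_of_tendsto_of_tendsto hcont hS ?_
    filter_upwards [hev] with t ht
    exact sum_le_hasSum _ (fun k _ => seriesTerm_nonneg n k ht.1.le) (hg t ht.1 ht.2)
  have hsum : Summable fun k : ℕ => seriesTerm n 1 (k + 1) :=
    summable_of_sum_range_le (fun k => seriesTerm_nonneg n k zero_le_one) hpartial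
  have hle : ∑' k : ℕ, seriesTerm n 1 (k + 1) ≤ S := hsum.tsum_le_of_sum_range_le hpartial
  have hge : S ≤ ∑' k : ℕ, seriesTerm n 1 (k + 1) := by
    refine le_of_tendsto hS ?_
    filter_upwards [hev] with t ht
    exact hasSum_le (fun k => seriesTerm_le_seriesTerm_one n k ht.1.le ht.2.le)
      (hg t ht.1 ht.2) hsum.hasSum
  exact le_antisymm hle hge ▸ hsum.hasSum

/-- For `0 < t < 1` the series converges to the closed form; at the endpoint `t = 1` the series
converges and the closed form, whose formula has `1 - t` in denominators, takes the value of the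
series there as its limit from the left. -/
theorem theorem2p12 (n : ℕ) (hn : 1 ≤ n) :
    (∀ t : ℝ, 0 < t → t < 1 →
      HasSum (fun k : ℕ => seriesTerm n t (k + 1)) (closedForm n t)) ∧
    (∃ S : ℝ, HasSum (fun k : ℕ => seriesTerm n 1 (k + 1)) S ∧
      Tendsto (fun t : ℝ => closedForm n t) (𝓝[<] (1 : ℝ)) (𝓝 S)) := by
  have hlt : ∀ t : ℝ, 0 < t → t < 1 →
      HasSum (fun k : ℕ => seriesTerm n t (k + 1)) (closedForm n t) := fun t h0 h1 => by
    rw [closedForm_eq h0 h1]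
    exact hasSum_seriesTerm n h0 h1
  exact ⟨hlt, harmonicPoly n 0, hasSum_seriesTerm_one hlt (tendsto_closedForm hn),
    tendsto_closedForm hn⟩
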